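/- Conventions. All extriangulated categories $(\mathcal D,\mathbb E,\mathfrak s)$ (in the sense of Nakaoka and Palu) have enough projectives and enough injectives and satisfy condition (WIC): if $gf$ is an inflation, so is $f$; if $gf$ is a deflation, so is $g$. A morphism is called compatible if, whenever it is both an inflation and a deflation, it is an isomorphism. A sequence $X\xrightarrow{f}Y\xrightarrow{g}Z$ is right exact if there are an $\mathbb E$-triangle $K\xrightarrow{h_2}Y\xrightarrow{g}Z\dashrightarrow$ and a compatible deflation $h_1:X\to K$ with $f=h_2h_1$; left exact sequences are defined dually. A four-term sequence $X\xrightarrow{f}Y\xrightarrow{g}Z\xrightarrow{h}W$ is right exact (resp. left exact) if there are $\mathbb E$-triangles $X\xrightarrow{f}Y\xrightarrow{g_1}K\dashrightarrow$ and $K\xrightarrow{g_2}Z\xrightarrow{h}W\dashrightarrow$ with $g=g_2g_1$ and $g_1$ (resp. $g_2$) compatible. An additive functor is right (left) exact if it preserves compatible morphisms and right (left) exact sequences. An additive functor $F$ is exact if it preserves compatible morphisms and there is a natural transformation $\eta:\mathbb E(-,-)\Rightarrow\mathbb E(F-,F-)$ of functors to abelian groups such that $\mathfrak s(\delta)=[X\xrightarrow{x}Y\xrightarrow{y}Z]$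 implies $\mathfrak s(\eta(\delta))=[FX\xrightarrow{Fx}FY\xrightarrow{Fy}FZ]$. A recollement $(\mathcal A,\mathcal B,\mathcal C)$ of extriangulated categories consists of exact functors $i_*:\mathcal A\to\mathcal B$ and $j^*:\mathcal B\to\mathcal C$, right exact functors $i^*:\mathcal B\to\mathcal A$ and $j_!:\mathcal C\to\mathcal B$, and left exact functors $i^!:\mathcal B\to\mathcal A$ and $j_*:\mathcal C\to\mathcal B$ such that $(i^*,i_*,i^!)$ and $(j_!,j^*,j_*)$ are adjoint triples; $\operatorname{Im} i_*=\operatorname{Ker} j^*$ (with $\operatorname{Im}$ closed under isomorphism); $i_*,j_!,j_*$ are fully faithful; and for each $B\in\mathcal B$ there are a left exact sequence $i_*i^!B\to B\to j_*j^*B\to i_*A$ and a right exact sequence $i_*A'\to j_!j^*B\to B\to i_*i^*B$ with $A,A'\in\mathcal A$, in which the maps into and out of $B$ are adjunction morphisms. Let $\mathcal P(\mathcal D)$ be the class of projective objects of $\mathcal D$. For a subcategory $\mathcal X$ of $\mathcal D$ and $M\in\mathcal D$, $\mathcal X\text{-}\mathrm{res}\,M\in\mathbb N\cup\{\infty\}$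 is the infimum of the $n\ge 0$ for which there are $\mathbb E$-triangles $K_{k+1}\to X_k\to K_k\dashrightarrow$ $(0\le k\le n)$ with $X_k\in\mathcal X$, $K_0=M$ and $K_{n+1}=0$. For a class $\mathcal Y$ of objects, $\mathcal X\text{-}\mathrm{res}\,\mathcal Y=\sup\{\mathcal X\text{-}\mathrm{res}\,M\mid M\in\mathcal Y\}$. Put $\mathrm{pd}_{\mathcal D}M=\mathcal P(\mathcal D)\text{-}\mathrm{res}\,M$ and $\mathrm{gl}\,\mathcal D=\mathcal P(\mathcal D)\text{-}\mathrm{res}\,\mathcal D$. Corollary. Let $(\mathcal A,\mathcal B,\mathcal C)$ be a recollement of extriangulated categories. The following inequalities hold in $\mathbb N\cup\{\infty\}$. (1) (a) $\mathrm{gl}\,\mathcal B\le \mathcal P(\mathcal B)\text{-}\mathrm{res}\,i_*(\mathcal A)+\mathrm{gl}\,\mathcal C+1$. (b) $\mathcal P(\mathcal B)\text{-}\mathrm{res}\,i_*(\mathcal A)\le \mathrm{gl}\,\mathcal A+\sup\{\mathrm{pd}_{\mathcal B}\,i_*(P)\mid P\in\mathcal P(\mathcal A)\}$. (c) $\mathrm{gl}\,\mathcal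 B\le \mathrm{gl}\,\mathcal A+\mathrm{gl}\,\mathcal C+\sup\{\mathrm{pd}_{\mathcal B}\,i_*(P)\mid P\in\mathcal P(\mathcal A)\}+1$. (d) $\mathrm{gl}\,\mathcal C\le \mathrm{gl}\,\mathcal B+\sup\{\mathrm{pd}_{\mathcal C}\,j^*(P)\mid P\in\mathcal P(\mathcal B)\}$. (2) If $i^!$ is exact, then (a) $\mathrm{gl}\,\mathcal B\le \mathrm{gl}\,\mathcal A+\mathrm{gl}\,\mathcal C+1$ and (b) $\mathrm{gl}\,\mathcal C\le\mathrm{gl}\,\mathcal B$. -/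

import Mathlib

open CategoryTheory CategoryTheory.Limits Opposite

universe w w₁ w₂ w₃ v v₁ v₂ v₃ u u₁ u₂ u₃

namespace Extri

/-! ### Extriangulated categories (Nakaoka and Palu) -/

section Bifunctor

/-- The group `𝔼(c, a)` of `𝔼`-extensions. -/
abbrev Extn {C : Type u} [Category.{v} C] (E : Cᵒᵖ ⥤ C ⥤ AddCommGrpCat.{w}) (c a : C) : Type w :=
  (E.obj (op c)).obj a

/-- `f_* δ`, covariance in the second variable. -/
def push {C : Type u} [Category.{v} C] (E : Cᵒᵖ ⥤ C ⥤ AddCommGrpCat.{w}) {c a a' : C}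
    (f : a ⟶ a') (δ : Extn E c a) : Extn E c a' :=
  ((E.obj (op c)).map f).hom δ

/-- `g^* δ`, contravariance in the first variable. -/
def pull {C : Type u} [Category.{v} C] (E : Cᵒᵖ ⥤ C ⥤ AddCommGrpCat.{w}) {c c' a : C}
    (g : c' ⟶ c) (δ : Extn E c a) : Extn E c' a :=
  ((E.map g.op).app a).hom δ

/-- The extension `δ ⊕ δ'` in `𝔼(c ⊕ c', a ⊕ a')`, with components `(δ, 0, 0, δ')`. -/
noncomputable def directSum {C : Type u} [Category.{v} C] [Preadditive C] [HasBinaryBiproducts C]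
    (E : Cᵒᵖ ⥤ C ⥤ AddCommGrpCat.{w}) {c c' a a' : C} (δ : Extn E c a) (δ' : Extn E c' a') :
    Extn E (c ⊞ c') (a ⊞ a') :=
  push E biprod.inl (pull E biprod.fst δ) + push E biprod.inr (pull E biprod.snd δ')

end Bifunctor

/-- A sequence `a ⟶ b ⟶ c` with prescribed end terms. -/
structure Seq {C : Type u} [Category.{v} C] (a c : C) where
  /-- the middle term -/
  mid : C
  /-- the first morphism -/
  x : a ⟶ mid
  /-- the second morphism -/
  y : mid ⟶ c

/-- Two sequences `a ⟶ b ⟶ c` and `a ⟶ b' ⟶ c` are equivalent if there is an isomorphism `b ≅ b'`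
compatible with the identities of `a` and `c`. -/
instance seqSetoid {C : Type u} [Category.{v} C] (a c : C) : Setoid (Seq a c) where
  r S T := ∃ e : S.mid ≅ T.mid, S.x ≫ e.hom = T.x ∧ e.hom ≫ T.y = S.y
  iseqv :=
    { refl := fun S => ⟨Iso.refl _, by simp, by simp⟩
      symm := by
        rintro S T ⟨e, h₁, h₂⟩
        exact ⟨e.symm, by simp [← h₁], by simp [← h₂]⟩
      trans := by
        rintro S T U ⟨e, h₁, h₂⟩ ⟨e', h₁', h₂'⟩
        exact ⟨e.trans e', by simp [← h₁', ← h₁], by simp [← h₂, ← h₂']⟩ }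

/-- Equivalence classes `[a ⟶ b ⟶ c]` of sequences. -/
def SeqClass {C : Type u} [Category.{v} C] (a c : C) : Type (max u v) :=
  Quotient (seqSetoid a c)

/-- The class `[a ⟶ b ⟶ c]` of a sequence. -/
def seqClass {C : Type u} [Category.{v} C] {a b c : C} (x : a ⟶ b) (y : b ⟶ c) : SeqClass a c :=
  Quotient.mk (seqSetoid a c) ⟨b, x, y⟩

/-- An extriangulated structure `(𝔼, 𝔰)` on an additive category, with the axioms of
Nakaoka and Palu. -/
class Extriangulated (C : Type u) [Category.{v} C] [Preadditive C] [HasZeroObject C]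
    [HasBinaryBiproducts C] where
  /-- the bifunctor `𝔼 : Cᵒᵖ × C ⥤ Ab` -/
  E : Cᵒᵖ ⥤ C ⥤ AddCommGrpCat.{w}
  /-- (ET1): `𝔼` is additive in the first variable -/
  additive_left : E.Additive
  /-- (ET1): `𝔼` is additive in the second variable -/
  additive_right : ∀ X : Cᵒᵖ, (E.obj X).Additive
  /-- the correspondence `𝔰` -/
  s : ∀ {c a : C}, Extn E c a → SeqClass a c
  /-- (ET2): `𝔰` is a realization: every morphism `(f, h) : δ ⟶ δ'` of extensions is
  realized by a morphism of sequences -/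
  realize_hom : ∀ {a b c a' b' c' : C} (x : a ⟶ b) (y : b ⟶ c) (x' : a' ⟶ b') (y' : b' ⟶ c')
    (δ : Extn E c a) (δ' : Extn E c' a'), s δ = seqClass x y → s δ' = seqClass x' y' →
    ∀ (f : a ⟶ a') (h : c ⟶ c'), push E f δ = pull E h δ' →
      ∃ g : b ⟶ b', x ≫ g = f ≫ x' ∧ y ≫ h = g ≫ y'
  /-- (ET2): the split extension is realized by the split sequence -/
  realize_zero : ∀ a c : C,
    s (0 : Extn E c a) = seqClass (biprod.inl : a ⟶ a ⊞ c) (biprod.snd : a ⊞ c ⟶ c)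
  /-- (ET2): `𝔰(δ ⊕ δ') = 𝔰(δ) ⊕ 𝔰(δ')` -/
  realize_directSum : ∀ {a b c a' b' c' : C} (x : a ⟶ b) (y : b ⟶ c) (x' : a' ⟶ b') (y' : b' ⟶ c')
    (δ : Extn E c a) (δ' : Extn E c' a'), s δ = seqClass x y → s δ' = seqClass x' y' →
      s (directSum E δ δ') = seqClass (biprod.map x x') (biprod.map y y')
  /-- (ET3) -/
  et3 : ∀ {a b c a' b' c' : C} (x : a ⟶ b) (y : b ⟶ c) (x' : a' ⟶ b') (y' : b' ⟶ c')
    (δ : Extn E c a) (δ' : Extn E c' a'), s δ = seqClass x y → s δ' = seqClass x' y' →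
    ∀ (f : a ⟶ a') (g : b ⟶ b'), x ≫ g = f ≫ x' →
      ∃ h : c ⟶ c', y ≫ h = g ≫ y' ∧ push E f δ = pull E h δ'
  /-- (ET3)ᵒᵖ -/
  et3_op : ∀ {a b c a' b' c' : C} (x : a ⟶ b) (y : b ⟶ c) (x' : a' ⟶ b') (y' : b' ⟶ c')
    (δ : Extn E c a) (δ' : Extn E c' a'), s δ = seqClass x y → s δ' = seqClass x' y' →
    ∀ (g : b ⟶ b') (h : c ⟶ c'), y ≫ h = g ≫ y' →
      ∃ f : a ⟶ a', x ≫ g = f ≫ x' ∧ push E f δ = pull E h δ'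
  /-- (ET4) -/
  et4 : ∀ {A B D K F : C} (f : A ⟶ B) (f' : B ⟶ D) (g : B ⟶ K) (g' : K ⟶ F)
    (δ : Extn E D A) (δ' : Extn E F B), s δ = seqClass f f' → s δ' = seqClass g g' →
    ∃ (L : C) (h' : K ⟶ L) (d : D ⟶ L) (e : L ⟶ F) (δ'' : Extn E L A),
      s δ'' = seqClass (f ≫ g) h' ∧ f' ≫ d = g ≫ h' ∧ h' ≫ e = g' ∧
      s (push E f' δ') = seqClass d e ∧ pull E d δ'' = δ ∧ push E f δ'' = pull E e δ'
  /-- (ET4)ᵒᵖ -/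
  et4_op : ∀ {A B D K F : C} (f' : D ⟶ A) (f : A ⟶ B) (g' : F ⟶ B) (g : B ⟶ K)
    (δ : Extn E B D) (δ' : Extn E K F), s δ = seqClass f' f → s δ' = seqClass g' g →
    ∃ (L : C) (h' : L ⟶ A) (d : D ⟶ L) (e : L ⟶ F) (δ'' : Extn E K L),
      s δ'' = seqClass h' (f ≫ g) ∧ d ≫ h' = f' ∧ e ≫ g' = h' ≫ f ∧
      s (pull E g' δ) = seqClass d e ∧ push E e δ'' = δ' ∧ push E d δ = pull E g δ''

section Basic

variable {C : Type u} [Category.{v} C] [Preadditive C] [HasZeroObject C] [HasBinaryBiproducts C]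
  [Extriangulated.{w} C]

/-- `a ⟶ b ⟶ c` is a conflation, i.e. part of an `𝔼`-triangle: it realizes some extension. -/
def IsConflation {a b c : C} (x : a ⟶ b) (y : b ⟶ c) : Prop :=
  ∃ δ : Extn (Extriangulated.E (C := C)) c a, Extriangulated.s δ = seqClass x y

/-- Inflations. -/
def IsInflation {a b : C} (x : a ⟶ b) : Prop :=
  ∃ (c : C) (y : b ⟶ c), IsConflation x y

/-- Deflations. -/
def IsDeflation {b c : C} (y : b ⟶ c) : Prop :=
  ∃ (a : C) (x : a ⟶ b), IsConflation x y

/-- A morphism is compatible if, as soon as it is both an inflation and a deflation, it is an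
isomorphism. -/
def IsCompatible {a b : C} (f : a ⟶ b) : Prop :=
  IsInflation f → IsDeflation f → IsIso f

/-- Projective objects: they lift along the deflation of every `𝔼`-triangle. -/
def projectives (C : Type u) [Category.{v} C] [Preadditive C] [HasZeroObject C]
    [HasBinaryBiproducts C] [Extriangulated.{w} C] : ObjectProperty C := fun P =>
  ∀ ⦃a b c : C⦄ (x : a ⟶ b) (y : b ⟶ c), IsConflation x y →
    ∀ f : P ⟶ c, ∃ g : P ⟶ b, g ≫ y = f

/-- Injective objects: they extend along the inflation of every `𝔼`-triangle. -/
def injectives (C : Type u) [Category.{v} C] [Preadditive C] [HasZeroObject C]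
    [HasBinaryBiproducts C] [Extriangulated.{w} C] : ObjectProperty C := fun I =>
  ∀ ⦃a b c : C⦄ (x : a ⟶ b) (y : b ⟶ c), IsConflation x y →
    ∀ f : a ⟶ I, ∃ g : b ⟶ I, x ≫ g = f

/-- Every object `M` is the end term of an `𝔼`-triangle `K ⟶ P ⟶ M` with `P` projective. -/
def HasEnoughProjectives (C : Type u) [Category.{v} C] [Preadditive C] [HasZeroObject C]
    [HasBinaryBiproducts C] [Extriangulated.{w} C] : Prop :=
  ∀ M : C, ∃ (K P : C) (x : K ⟶ P) (y : P ⟶ M), IsConflation x y ∧ projectives C P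

/-- Every object `M` is the first term of an `𝔼`-triangle `M ⟶ I ⟶ L` with `I` injective. -/
def HasEnoughInjectives (C : Type u) [Category.{v} C] [Preadditive C] [HasZeroObject C]
    [HasBinaryBiproducts C] [Extriangulated.{w} C] : Prop :=
  ∀ M : C, ∃ (I L : C) (x : M ⟶ I) (y : I ⟶ L), IsConflation x y ∧ injectives C I

/-- Condition (WIC). -/
def WIC (C : Type u) [Category.{v} C] [Preadditive C] [HasZeroObject C]
    [HasBinaryBiproducts C] [Extriangulated.{w} C] : Prop :=
  ∀ ⦃X Y Z : C⦄ (f : X ⟶ Y) (g : Y ⟶ Z),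
    (IsInflation (f ≫ g) → IsInflation f) ∧ (IsDeflation (f ≫ g) → IsDeflation g)

/-! ### Left and right exact sequences -/

/-- `a ⟶ b ⟶ c` is right exact: `f` is a compatible deflation onto the cocone of `g`. -/
def IsRightExactSeq {a b c : C} (f : a ⟶ b) (g : b ⟶ c) : Prop :=
  ∃ (K : C) (h₁ : a ⟶ K) (h₂ : K ⟶ b),
    IsConflation h₂ g ∧ IsDeflation h₁ ∧ IsCompatible h₁ ∧ f = h₁ ≫ h₂

/-- `a ⟶ b ⟶ c` is left exact: `g` is the cone of `f` followed by a compatible inflation. -/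
def IsLeftExactSeq {a b c : C} (f : a ⟶ b) (g : b ⟶ c) : Prop :=
  ∃ (K : C) (h₁ : b ⟶ K) (h₂ : K ⟶ c),
    IsConflation f h₁ ∧ IsInflation h₂ ∧ IsCompatible h₂ ∧ g = h₁ ≫ h₂

/-- The four term `𝔼`-triangle sequence `a ⟶ b ⟶ c ⟶ d` is right exact. -/
def IsRightExactSeq₄ {a b c d : C} (f : a ⟶ b) (g : b ⟶ c) (h : c ⟶ d) : Prop :=
  ∃ (K : C) (g₁ : b ⟶ K) (g₂ : K ⟶ c),
    IsConflation f g₁ ∧ IsConflation g₂ h ∧ g = g₁ ≫ g₂ ∧ IsCompatible g₁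

/-- The four term `𝔼`-triangle sequence `a ⟶ b ⟶ c ⟶ d` is left exact. -/
def IsLeftExactSeq₄ {a b c d : C} (f : a ⟶ b) (g : b ⟶ c) (h : c ⟶ d) : Prop :=
  ∃ (K : C) (g₁ : b ⟶ K) (g₂ : K ⟶ c),
    IsConflation f g₁ ∧ IsConflation g₂ h ∧ g = g₁ ≫ g₂ ∧ IsCompatible g₂

/-! ### Resolution dimension -/

/-- An `𝔼`-triangle sequence `0 ⟶ X_n ⟶ ⋯ ⟶ X_1 ⟶ X_0 ⟶ M ⟶ 0` with all `X_k` in `𝒳`: for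
`0 ≤ k ≤ n` there are `𝔼`-triangles `K_{k+1} ⟶ X_k ⟶ K_k` with `K_0 = M` and `K_{n+1} = 0`, and
the differentials are the composites `X_{k+1} ⟶ K_{k+1} ⟶ X_k`. Terms and morphisms with index
beyond this range play no role. -/
structure Resolution (𝒳 : ObjectProperty C) (n : ℕ) (M : C) where
  /-- the terms -/
  X : ℕ → C
  /-- the syzygies -/
  K : ℕ → C
  /-- the morphism `K_{k+1} ⟶ X_k` -/
  g : ∀ k, K (k + 1) ⟶ X k
  /-- the morphism `X_k ⟶ K_k` -/
  f : ∀ k, X k ⟶ K k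
  mem : ∀ k ≤ n, 𝒳 (X k)
  conflation : ∀ k ≤ n, IsConflation (g k) (f k)
  start : K 0 = M
  finish : IsZero (K (n + 1))

/-- The `𝒳`-resolution dimension of an object; it is `⊤` if there is no finite resolution. -/
noncomputable def resDim (𝒳 : ObjectProperty C) (M : C) : ℕ∞ :=
  ⨅ (n : ℕ) (_ : Nonempty (Resolution 𝒳 n M)), (n : ℕ∞)

/-- The `𝒳`-resolution dimension of a class `𝒴` of objects: the supremum of the `𝒳`-resolution
dimensions of its members. -/
noncomputable def resDimClass (𝒳 𝒴 : ObjectProperty C) : ℕ∞ :=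
  ⨆ (M : C) (_ : 𝒴 M), resDim 𝒳 M

/-- The projective dimension of an object. -/
noncomputable def pd (M : C) : ℕ∞ :=
  resDim (projectives C) M

/-- The global dimension of an extriangulated category. -/
noncomputable def gl (C : Type u) [Category.{v} C] [Preadditive C] [HasZeroObject C]
    [HasBinaryBiproducts C] [Extriangulated.{w} C] : ℕ∞ :=
  resDimClass (projectives C) ⊤

end Basic

/-! ### Exact functors and recollements -/

section Functors

variable {C : Type u₁} [Category.{v₁} C] [Preadditive C] [HasZeroObject C] [HasBinaryBiproducts C]
  [Extriangulated.{w₁} C]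
  {D : Type u₂} [Category.{v₂} D] [Preadditive D] [HasZeroObject D] [HasBinaryBiproducts D]
  [Extriangulated.{w₂} D]

/-- Right exact functors: additive functors that preserve compatible morphisms and right exact
sequences. -/
structure IsRightExact (F : C ⥤ D) : Prop where
  additive : F.Additive
  compatible : ∀ {a b : C} (f : a ⟶ b), IsCompatible f → IsCompatible (F.map f)
  rightExact : ∀ {a b c : C} (f : a ⟶ b) (g : b ⟶ c),
    IsRightExactSeq f g → IsRightExactSeq (F.map f) (F.map g)

/-- Left exact functors: additive functors that preserve compatible morphisms and left exact
sequences. -/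
structure IsLeftExact (F : C ⥤ D) : Prop where
  additive : F.Additive
  compatible : ∀ {a b : C} (f : a ⟶ b), IsCompatible f → IsCompatible (F.map f)
  leftExact : ∀ {a b c : C} (f : a ⟶ b) (g : b ⟶ c),
    IsLeftExactSeq f g → IsLeftExactSeq (F.map f) (F.map g)

/-- A natural transformation `η : 𝔼_C(-, -) ⟶ 𝔼_D(F -, F -)` of functors to abelian groups such
that `𝔰(δ) = [a ⟶ b ⟶ c]` implies `𝔰(η(δ)) = [F a ⟶ F b ⟶ F c]`. -/
structure ExtriangulatedTrans (F : C ⥤ D) where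
  /-- the components of `η` -/
  η : ∀ c a : C, Extn (Extriangulated.E (C := C)) c a →+
    Extn (Extriangulated.E (C := D)) (F.obj c) (F.obj a)
  natural_push : ∀ {c a a' : C} (f : a ⟶ a') (δ : Extn (Extriangulated.E (C := C)) c a),
    η c a' (push _ f δ) = push _ (F.map f) (η c a δ)
  natural_pull : ∀ {c c' a : C} (g : c' ⟶ c) (δ : Extn (Extriangulated.E (C := C)) c a),
    η c' a (pull _ g δ) = pull _ (F.map g) (η c a δ)
  realize : ∀ {a b c : C} (x : a ⟶ b) (y : b ⟶ c) (δ : Extn (Extriangulated.E (C := C)) c a),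
    Extriangulated.s δ = seqClass x y →
      Extriangulated.s (η c a δ) = seqClass (F.map x) (F.map y)

/-- Exact functors: additive functors that preserve compatible morphisms and carry `𝔼`-triangles
to `𝔼`-triangles through a natural transformation of the bifunctors `𝔼`. -/
structure IsExact (F : C ⥤ D) : Prop where
  additive : F.Additive
  compatible : ∀ {a b : C} (f : a ⟶ b), IsCompatible f → IsCompatible (F.map f)
  exact : Nonempty (ExtriangulatedTrans F)

end Functors

/-- A recollement of `B` relative to `A` and `C`. -/
structure Recollement
    (A : Type u₁) [Category.{v₁} A] [Preadditive A] [HasZeroObject A] [HasBinaryBiproducts A]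
    [Extriangulated.{w₁} A]
    (B : Type u₂) [Category.{v₂} B] [Preadditive B] [HasZeroObject B] [HasBinaryBiproducts B]
    [Extriangulated.{w₂} B]
    (C : Type u₃) [Category.{v₃} C] [Preadditive C] [HasZeroObject C] [HasBinaryBiproducts C]
    [Extriangulated.{w₃} C] where
  /-- `i^*` -/
  iPull : B ⥤ A
  /-- `i_*` -/
  iPush : A ⥤ B
  /-- `i^!` -/
  iShriek : B ⥤ A
  /-- `j_!` -/
  jShriek : C ⥤ B
  /-- `j^*` -/
  jPull : B ⥤ C
  /-- `j_*` -/
  jPush : C ⥤ B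
  iPush_exact : IsExact iPush
  jPull_exact : IsExact jPull
  iPull_rightExact : IsRightExact iPull
  jShriek_rightExact : IsRightExact jShriek
  iShriek_leftExact : IsLeftExact iShriek
  jPush_leftExact : IsLeftExact jPush
  /-- (R1): `i^* ⊣ i_*` -/
  adjPullPush_i : iPull ⊣ iPush
  /-- (R1): `i_* ⊣ i^!` -/
  adjPushShriek_i : iPush ⊣ iShriek
  /-- (R1): `j_! ⊣ j^*` -/
  adjShriekPull_j : jShriek ⊣ jPull
  /-- (R1): `j^* ⊣ j_*` -/
  adjPullPush_j : jPull ⊣ jPush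
  /-- (R2): `Im i_* = Ker j^*` -/
  im_eq_ker : ∀ X : B, iPush.essImage X ↔ IsZero (jPull.obj X)
  /-- (R3) -/
  iPush_full : iPush.Full
  iPush_faithful : iPush.Faithful
  jShriek_full : jShriek.Full
  jShriek_faithful : jShriek.Faithful
  jPush_full : jPush.Full
  jPush_faithful : jPush.Faithful
  /-- (R4): a left exact sequence `i_* i^! X ⟶ X ⟶ j_* j^* X ⟶ i_* Y` -/
  leftSeq : ∀ X : B, ∃ (Y : A) (h : jPush.obj (jPull.obj X) ⟶ iPush.obj Y),
    IsLeftExactSeq₄ (adjPushShriek_i.counit.app X) (adjPullPush_j.unit.app X) h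
  /-- (R5): a right exact sequence `i_* Y ⟶ j_! j^* X ⟶ X ⟶ i_* i^* X` -/
  rightSeq : ∀ X : B, ∃ (Y : A) (h : iPush.obj Y ⟶ jShriek.obj (jPull.obj X)),
    IsRightExactSeq₄ h (adjShriekPull_j.counit.app X) (adjPullPush_i.unit.app X)

end Extri

open Extri

namespace Extri

open scoped ZeroObject

/-! Projective dimension is turned into a vanishing condition: with enough projectives and
injectives, `pd M ≤ n` holds exactly when 𝔼(M, N) = 0 for every n-th cosyzygy N (`pd_le_iff`). This
stands in for the vanishing of 𝔼ⁿ⁺¹(M, -), so no higher extension groups are constructed. Short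
exactness properties of 𝔼 then give dimension shifting along conflations.

For (1)(a), let m bound the degrees on the image of `i_*` and n those on C. Applying `j_!` to a
syzygy conflation in C loses exactness only by an object coming from A
(`exists_conflations_jShriek`), and `j_!` preserves projectives, so induction bounds the degrees of
all `j_! Y` by m + n + 1. The sequence (R5) transfers this bound to every object of B.

Parts (1)(b) and (1)(d) come from one estimate for exact functors (`IsExact.pd_map_le`), the latter
through `Y ≅ j^* j_! Y`; (1)(c) combines (1)(a) and (1)(b). If `i^!` is exact, then `i_*` and `j^*`
preserve projectives, and the suprema in (1)(c) and (1)(d) are zero. -/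

lemma seqClass_eq_of_iso {C : Type u} [Category.{v} C] {a b b' c : C} {x : a ⟶ b} {y : b ⟶ c} {x' : a ⟶ b'} {y' : b' ⟶ c}
    (e : b ≅ b') (h₁ : x ≫ e.hom = x') (h₂ : e.hom ≫ y' = y) :
    seqClass x y = seqClass x' y' :=
  Quotient.sound ⟨e, h₁, h₂⟩

lemma exists_iso_of_seqClass_eq {C : Type u} [Category.{v} C] {a b b' c : C} {x : a ⟶ b} {y : b ⟶ c} {x' : a ⟶ b'}
    {y' : b' ⟶ c} (h : seqClass x y = seqClass x' y') :
    ∃ e : b ≅ b', x ≫ e.hom = x' ∧ e.hom ≫ y' = y :=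
  Quotient.exact h

lemma isIso_of_isZero {C : Type u} [Category.{v} C] [Preadditive C] {a b : C} (ha : IsZero a) (hb : IsZero b) (f : a ⟶ b) : IsIso f :=
  ⟨0, ha.eq_of_src _ _, hb.eq_of_src _ _⟩

/-! ### Functoriality of extension groups -/

section Extensions

variable {C : Type u} [Category.{v} C] (E : Cᵒᵖ ⥤ C ⥤ AddCommGrpCat.{w})

@[simp] lemma push_id {c a : C} (δ : Extn E c a) : push E (𝟙 a) δ = δ := by
  simp [push]

@[simp] lemma pull_id {c a : C} (δ : Extn E c a) : pull E (𝟙 c) δ = δ := by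
  simp [pull]

lemma push_comp {c a a' a'' : C} (f : a ⟶ a') (f' : a' ⟶ a'') (δ : Extn E c a) :
    push E (f ≫ f') δ = push E f' (push E f δ) := by
  simp [push]

lemma pull_comp {c c' c'' a : C} (g : c' ⟶ c) (g' : c'' ⟶ c') (δ : Extn E c a) :
    pull E (g' ≫ g) δ = pull E g' (pull E g δ) := by
  simp [pull]

lemma pull_push {c c' a a' : C} (f : a ⟶ a') (g : c' ⟶ c) (δ : Extn E c a) :
    pull E g (push E f δ) = push E f (pull E g δ) := by
  simp [push, pull]

@[simp] lemma push_map_zero {c a a' : C} (f : a ⟶ a') : push E f (0 : Extn E c a) = 0 :=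
  map_zero _

@[simp] lemma pull_map_zero {c c' a : C} (g : c' ⟶ c) : pull E g (0 : Extn E c a) = 0 :=
  map_zero _

end Extensions

/-! ### Trivial conflations and composition of inflations and deflations -/

section Basic

variable {C : Type u} [Category.{v} C] [Preadditive C] [HasZeroObject C] [HasBinaryBiproducts C]
  [Extriangulated.{w} C]

local notation "𝔼" => Extriangulated.E (C := C)

lemma push_zero_hom {c a a' : C} (δ : Extn 𝔼 c a) : push 𝔼 (0 : a ⟶ a') δ = 0 := by
  have := Extriangulated.additive_right (C := C) (op c)
  have : ((Extriangulated.E (C := C)).obj (op c)).map (0 : a ⟶ a') = 0 := Functor.map_zero _ _ _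
  simp [push, this]

lemma pull_zero_hom {c c' a : C} (δ : Extn 𝔼 c a) : pull 𝔼 (0 : c' ⟶ c) δ = 0 := by
  have := Extriangulated.additive_left (C := C)
  have : (Extriangulated.E (C := C)).map (0 : c' ⟶ c).op = 0 := by
    rw [op_zero]; exact Functor.map_zero _ _ _
  simp [pull]

lemma exists_seqClass_eq {c a : C} (δ : Extn 𝔼 c a) :
    ∃ (b : C) (x : a ⟶ b) (y : b ⟶ c), Extriangulated.s δ = seqClass x y := by
  obtain ⟨⟨b, x, y⟩, h⟩ := Quotient.exists_rep (Extriangulated.s δ)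
  exact ⟨b, x, y, h.symm⟩

/-- The zero extension of a zero object is realized by any isomorphism. -/
lemma s_zero_of_isIso_left {a b c : C} (x : a ⟶ b) [IsIso x] (hc : IsZero c) :
    Extriangulated.s (0 : Extn 𝔼 c a) = seqClass x (0 : b ⟶ c) := by
  rw [Extriangulated.realize_zero]
  refine seqClass_eq_of_iso ⟨biprod.fst ≫ x, inv x ≫ biprod.inl, ?_, ?_⟩ (by simp)
    (hc.eq_of_tgt _ _)
  · ext
    · simp
    · simp
    · simp
    · exact hc.eq_of_tgt _ _
  · simp

lemma s_zero_of_isIso_right {a b c : C} (y : b ⟶ c) [IsIso y] (ha : IsZero a) :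
    Extriangulated.s (0 : Extn 𝔼 c a) = seqClass (0 : a ⟶ b) y := by
  rw [Extriangulated.realize_zero]
  refine seqClass_eq_of_iso ⟨biprod.snd ≫ inv y, y ≫ biprod.inr, ?_, ?_⟩ (ha.eq_of_src _ _)
    (by simp)
  · ext
    · exact ha.eq_of_src _ _
    · exact ha.eq_of_src _ _
    · simp
    · simp
  · simp

lemma isInflation_of_isIso {a b : C} (x : a ⟶ b) [IsIso x] : IsInflation x :=
  ⟨0, 0, 0, s_zero_of_isIso_left x (isZero_zero C)⟩

lemma isDeflation_of_isIso {b c : C} (y : b ⟶ c) [IsIso y] : IsDeflation y :=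
  ⟨0, 0, 0, s_zero_of_isIso_right y (isZero_zero C)⟩

lemma IsInflation.comp {a b c : C} {f : a ⟶ b} {g : b ⟶ c} (hf : IsInflation f)
    (hg : IsInflation g) : IsInflation (f ≫ g) := by
  obtain ⟨_, f', δ, hδ⟩ := hf
  obtain ⟨_, g', δ', hδ'⟩ := hg
  obtain ⟨L, h', _, _, δ'', h, -⟩ := Extriangulated.et4 f f' g g' δ δ' hδ hδ'
  exact ⟨L, h', δ'', h⟩

lemma IsDeflation.comp {a b c : C} {f : a ⟶ b} {g : b ⟶ c} (hf : IsDeflation f)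
    (hg : IsDeflation g) : IsDeflation (f ≫ g) := by
  obtain ⟨_, f', δ, hδ⟩ := hf
  obtain ⟨_, g', δ', hδ'⟩ := hg
  obtain ⟨L, h', _, _, δ'', h, -⟩ := Extriangulated.et4_op f' f g' g δ δ' hδ hδ'
  exact ⟨L, h', δ'', h⟩

/-! ### Exactness properties of 𝔼 along a conflation -/

section Exactness

variable {a b c : C} {x : a ⟶ b} {y : b ⟶ c}

/-- (ET3) compares the conflation with the trivial one `b = b ⟶ 0`, whose extension is zero. -/
lemma push_inflation_eq_zero {δ : Extn 𝔼 c a} (h : Extriangulated.s δ = seqClass x y) : push 𝔼 x δ = 0 := by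
  obtain ⟨k, -, hk⟩ := Extriangulated.et3 x y (𝟙 b) (0 : b ⟶ 0) δ 0 h
    (s_zero_of_isIso_left (𝟙 b) (isZero_zero C)) x (𝟙 b) rfl
  simpa using hk

lemma pull_deflation_eq_zero {δ : Extn 𝔼 c a} (h : Extriangulated.s δ = seqClass x y) : pull 𝔼 y δ = 0 := by
  obtain ⟨k, -, hk⟩ := Extriangulated.et3_op (0 : (0 : C) ⟶ b) (𝟙 b) x y 0 δ
    (s_zero_of_isIso_right (𝟙 b) (isZero_zero C)) h (𝟙 b) y rfl
  simpa using hk.symm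

lemma exists_lift_of_pull_eq_zero {δ : Extn 𝔼 c a} (h : Extriangulated.s δ = seqClass x y) {T : C} (f : T ⟶ c)
    (hf : pull 𝔼 f δ = 0) : ∃ g : T ⟶ b, g ≫ y = f := by
  obtain ⟨k, -, hk⟩ := Extriangulated.realize_hom _ _ x y (0 : Extn 𝔼 T a) δ
    (Extriangulated.realize_zero a T) h (𝟙 a) f (by simp [hf])
  exact ⟨biprod.inr ≫ k, by rw [Category.assoc, ← hk]; simp⟩

lemma exists_desc_of_push_eq_zero {δ : Extn 𝔼 c a} (h : Extriangulated.s δ = seqClass x y) {T : C} (f : a ⟶ T)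
    (hf : push 𝔼 f δ = 0) : ∃ g : b ⟶ T, x ≫ g = f := by
  obtain ⟨k, hk, -⟩ := Extriangulated.realize_hom x y _ _ δ (0 : Extn 𝔼 c T) h
    (Extriangulated.realize_zero T c) f (𝟙 c) (by simp [hf])
  exact ⟨k ≫ biprod.fst, by rw [← Category.assoc, hk]; simp⟩

/-- The vanishing lets `x` extend over the middle term of a realization of `ε`; (ET3) completes this
to a morphism of extensions that is the identity on `a`. -/
lemma exists_pull_eq_of_push_eq_zero {δ : Extn 𝔼 c a} (h : Extriangulated.s δ = seqClass x y) {T : C}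
    (ε : Extn 𝔼 T a) (hε : push 𝔼 x ε = 0) : ∃ φ : T ⟶ c, ε = pull 𝔼 φ δ := by
  obtain ⟨Z, u, t, hZ⟩ := exists_seqClass_eq ε
  obtain ⟨k, hk⟩ := exists_desc_of_push_eq_zero hZ x hε
  obtain ⟨φ, -, hφ⟩ := Extriangulated.et3 u t x y ε δ hZ h (𝟙 a) k (by simp [hk])
  exact ⟨φ, by simpa using hφ⟩

lemma exists_push_eq_of_pull_eq_zero {δ : Extn 𝔼 c a} (h : Extriangulated.s δ = seqClass x y) {T : C}
    (ε : Extn 𝔼 c T) (hε : pull 𝔼 y ε = 0) : ∃ φ : a ⟶ T, ε = push 𝔼 φ δ := by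
  obtain ⟨Z, u, t, hZ⟩ := exists_seqClass_eq ε
  obtain ⟨k, hk⟩ := exists_lift_of_pull_eq_zero hZ y hε
  obtain ⟨φ, -, hφ⟩ := Extriangulated.et3_op x y u t δ ε h hZ k (𝟙 c) (by simp [hk])
  exact ⟨φ, by simpa using hφ.symm⟩

/-- Exactness of `𝔼(c, T) ⟶ 𝔼(b, T) ⟶ 𝔼(a, T)`. -/
lemma exists_pull_eq_of_pull_eq_zero {δ : Extn 𝔼 c a} (h : Extriangulated.s δ = seqClass x y) {T : C}
    (ε : Extn 𝔼 b T) (hε : pull 𝔼 x ε = 0) : ∃ θ : Extn 𝔼 c T, ε = pull 𝔼 y θ := by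
  obtain ⟨Z, u, t, hZ⟩ := exists_seqClass_eq ε
  -- The composite deflation `Z ⟶ b ⟶ c` has cocone `L`, an extension of `a` by `T` realizing `x^* ε
  -- = 0`. Hence `d` has a retraction `r`, and pushing `d_* ε = y^* δ''` along `r` recovers `ε`.
  obtain ⟨L, h', d, e, δ'', -, -, -, hde, -, hd⟩ := Extriangulated.et4_op u t x y ε δ hZ h
  obtain ⟨r, hr⟩ := exists_desc_of_push_eq_zero hde (𝟙 T) (by simp [hε])
  refine ⟨push 𝔼 r δ'', ?_⟩
  rw [pull_push, ← hd, ← push_comp, hr, push_id]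

/-- A conflation whose deflation is invertible starts at a zero object. -/
lemma IsConflation.isZero_left (h : IsConflation x y) [IsIso y] : IsZero a := by
  obtain ⟨δ, hδ⟩ := h
  have h0 : δ = 0 := by
    rw [← pull_id _ δ, ← IsIso.inv_hom_id y, pull_comp, pull_deflation_eq_zero hδ, pull_map_zero]
  rw [h0, Extriangulated.realize_zero] at hδ
  obtain ⟨e, -, he⟩ := exists_iso_of_seqClass_eq hδ
  have : IsIso (biprod.snd : a ⊞ c ⟶ c) := by rw [← he]; infer_instance
  have h1 : (biprod.inl : a ⟶ a ⊞ c) = 0 := by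
    rw [← cancel_mono (biprod.snd : a ⊞ c ⟶ c)]; simp
  rw [IsZero.iff_id_eq_zero, ← biprod.inl_fst (X := a) (Y := c), h1, zero_comp]

/-- A conflation whose inflation is invertible ends at a zero object. -/
lemma IsConflation.isZero_right (h : IsConflation x y) [IsIso x] : IsZero c := by
  obtain ⟨δ, hδ⟩ := h
  have h0 : δ = 0 := by
    rw [← push_id _ δ, ← IsIso.hom_inv_id x, push_comp, push_inflation_eq_zero hδ, push_map_zero]
  rw [h0, Extriangulated.realize_zero] at hδ
  obtain ⟨e, he, -⟩ := exists_iso_of_seqClass_eq hδ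
  have : IsIso (biprod.inl : a ⟶ a ⊞ c) := by
    have hx : biprod.inl = x ≫ e.inv := (Iso.eq_comp_inv e).2 he
    rw [hx]; infer_instance
  have h1 : (biprod.snd : a ⊞ c ⟶ c) = 0 := by
    rw [← cancel_epi (biprod.inl : a ⟶ a ⊞ c)]; simp
  rw [IsZero.iff_id_eq_zero, ← biprod.inr_snd (X := a) (Y := c), h1, comp_zero]

/-- An inflation with zero cone is invertible. -/
lemma IsConflation.isIso_of_isZero (h : IsConflation x y) (hc : IsZero c) : IsIso x := by
  obtain ⟨δ, hδ⟩ := h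
  have h0 : δ = 0 := by rw [← pull_id _ δ, hc.eq_of_src (𝟙 c) 0, pull_zero_hom]
  rw [h0, s_zero_of_isIso_left (𝟙 a) hc] at hδ
  obtain ⟨e, he, -⟩ := exists_iso_of_seqClass_eq hδ
  rw [← he]; infer_instance

end Exactness

/-- Lifting the identity of `P` through a realization splits the extension; conversely, the
obstruction to lifting `f` is `f^* δ`. -/
lemma projectives_iff_extn_eq_zero {P : C} :
    projectives C P ↔ ∀ (N : C) (δ : Extn 𝔼 P N), δ = 0 := by
  constructor
  · intro hP N δ
    obtain ⟨Z, u, t, hZ⟩ := exists_seqClass_eq δ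
    obtain ⟨g, hg⟩ := hP u t ⟨δ, hZ⟩ (𝟙 P)
    rw [← pull_id _ δ, ← hg, pull_comp, pull_deflation_eq_zero hZ, pull_map_zero]
  · rintro h a b c x y ⟨δ, hδ⟩ f
    exact exists_lift_of_pull_eq_zero hδ f (h _ _)

lemma injectives.extn_eq_zero {I : C} (hI : injectives C I) {c : C} (δ : Extn 𝔼 c I) : δ = 0 := by
  obtain ⟨Z, u, t, hZ⟩ := exists_seqClass_eq δ
  obtain ⟨g, hg⟩ := hI u t ⟨δ, hZ⟩ (𝟙 I)
  rw [← push_id _ δ, ← hg, push_comp, push_inflation_eq_zero hZ, push_map_zero]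

/-! ### Projective dimension through vanishing of extensions by cosyzygies -/

/-- The `n`-th cosyzygies of objects of `C`. -/
def IsCosyzygy : ℕ → C → Prop
  | 0, _ => True
  | n + 1, L => ∃ (N I : C) (x : N ⟶ I) (y : I ⟶ L),
      IsConflation x y ∧ injectives C I ∧ IsCosyzygy n N

/-- The extensions of `M` by all `n`-th cosyzygies vanish, i.e. `𝔼ⁿ⁺¹(M, -) = 0`. -/
def ExtVanish (n : ℕ) (M : C) : Prop :=
  ∀ N : C, IsCosyzygy n N → ∀ δ : Extn 𝔼 M N, δ = 0

/-- Forgetting the first step is harmless, since every object counts as a zeroth cosyzygy. -/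
lemma IsCosyzygy.of_succ {n : ℕ} {N : C} (h : IsCosyzygy (n + 1) N) : IsCosyzygy n N := by
  induction n generalizing N with
  | zero => trivial
  | succ n ih =>
    obtain ⟨N', I, x, y, hxy, hI, hN'⟩ := h
    exact ⟨N', I, x, y, hxy, hI, ih hN'⟩

lemma ExtVanish.mono {m n : ℕ} {M : C} (h : ExtVanish m M) (hmn : m ≤ n) : ExtVanish n M := by
  induction hmn with
  | refl => exact h
  | step _ ih => exact fun N hN => ih N hN.of_succ

lemma extVanish_zero_iff {M : C} : ExtVanish 0 M ↔ projectives C M := by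
  rw [projectives_iff_extn_eq_zero]
  exact ⟨fun h N => h N trivial, fun h N _ => h N⟩

lemma ExtVanish.of_iso {n : ℕ} {M M' : C} (h : ExtVanish n M) (e : M ≅ M') : ExtVanish n M' := by
  intro N hN δ
  rw [← pull_id _ δ, ← e.inv_hom_id, pull_comp, h N hN (pull 𝔼 e.hom δ), pull_map_zero]

variable {a b c : C} {x : a ⟶ b} {y : b ⟶ c}

lemma IsConflation.extVanish_mid (h : IsConflation x y) {n : ℕ} (ha : ExtVanish n a)
    (hc : ExtVanish n c) : ExtVanish n b := by
  obtain ⟨δ, hδ⟩ := h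
  intro N hN ε
  obtain ⟨θ, rfl⟩ := exists_pull_eq_of_pull_eq_zero hδ ε (ha N hN _)
  rw [hc N hN θ, pull_map_zero]

/-- An extension of `c` that dies on `b` is `φ_* δ` for some `φ : a ⟶ L`. As `L` is the cone of `N ⟶
I` and 𝔼(a, N) = 0, `φ` factors through the injective `I`, where the pushed extension vanishes. -/
lemma IsConflation.extVanish_right (h : IsConflation x y) {n : ℕ} (ha : ExtVanish n a)
    (hb : ExtVanish (n + 1) b) : ExtVanish (n + 1) c := by
  obtain ⟨δ, hδ⟩ := h
  rintro L hL ε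
  obtain ⟨φ, rfl⟩ := exists_push_eq_of_pull_eq_zero hδ ε (hb L hL _)
  obtain ⟨N, I, u, t, ⟨ν, hν⟩, hI, hN⟩ := hL
  obtain ⟨ψ, rfl⟩ := exists_lift_of_pull_eq_zero hν φ (ha N hN _)
  rw [push_comp, hI.extn_eq_zero (push 𝔼 ψ δ), push_map_zero]

/-- Needed at the end of a resolution, where `extVanish_right` would not give degree zero. -/
lemma IsConflation.extVanish_of_isZero (h : IsConflation x y) {n : ℕ} (ha : IsZero a)
    (hb : ExtVanish n b) : ExtVanish n c := by
  obtain ⟨δ, hδ⟩ := h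
  rintro L hL ε
  obtain ⟨φ, rfl⟩ := exists_push_eq_of_pull_eq_zero hδ ε (hb L hL _)
  rw [ha.eq_of_src φ 0, push_zero_hom]

/-- Embed `N` in an injective with cone `L`: the extension becomes a pullback along some `a ⟶ L`,
which extends to `b` because 𝔼(c, L) = 0. It therefore comes from 𝔼(b, N), zero by projectivity. -/
lemma IsConflation.extVanish_left (inj : HasEnoughInjectives C) (h : IsConflation x y) {n : ℕ}
    (hb : projectives C b) (hc : ExtVanish (n + 1) c) : ExtVanish n a := by
  obtain ⟨δ, hδ⟩ := h
  intro N hN ε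
  obtain ⟨I, L, u, t, hut, hI⟩ := inj N
  have hL : IsCosyzygy (n + 1) L := ⟨N, I, u, t, hut, hI, hN⟩
  obtain ⟨ν, hν⟩ := hut
  obtain ⟨φ, rfl⟩ := exists_pull_eq_of_push_eq_zero hν ε (hI.extn_eq_zero _)
  obtain ⟨ψ, rfl⟩ := exists_desc_of_push_eq_zero hδ φ (hc L hL _)
  rw [pull_comp, projectives_iff_extn_eq_zero.1 hb _ (pull 𝔼 ψ ν), pull_map_zero]

lemma Resolution.extVanish {n : ℕ} {M : C} (r : Resolution (projectives C) n M) :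
    ExtVanish n M := by
  -- Induction runs from the zero end of the resolution back to `M`.
  have key : ∀ j ≤ n, ExtVanish j (r.K (n - j)) := by
    intro j
    induction j with
    | zero =>
      intro _
      exact (r.conflation n le_rfl).extVanish_of_isZero r.finish
        (extVanish_zero_iff.2 (r.mem n le_rfl))
    | succ j ih =>
      intro hj
      have h := ih (by omega)
      rw [show n - j = n - (j + 1) + 1 by omega] at h
      exact (r.conflation (n - (j + 1)) (by omega)).extVanish_right h
        ((extVanish_zero_iff.2 (r.mem _ (by omega))).mono (by omega))
  have h := key n le_rfl
  rwa [Nat.sub_self, r.start] at h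

/-- The resolution of length zero of an object of `𝒳`. -/
noncomputable def Resolution.ofMem {𝒳 : ObjectProperty C} {M : C} (hM : 𝒳 M) :
    Resolution 𝒳 0 M where
  X _ := M
  K | 0 => M | _ + 1 => 0
  g _ := 0
  f | 0 => 𝟙 M | _ + 1 => 0
  mem _ _ := hM
  conflation k hk := by
    obtain rfl : k = 0 := by omega
    exact ⟨0, s_zero_of_isIso_right (𝟙 M) (isZero_zero C)⟩
  start := rfl
  finish := isZero_zero C

/-- Prolongation of a resolution by a conflation. -/
def Resolution.cons {𝒳 : ObjectProperty C} {n : ℕ} {K X M : C} (g : K ⟶ X) (f : X ⟶ M)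
    (h : IsConflation g f) (hX : 𝒳 X) (r : Resolution 𝒳 n K) : Resolution 𝒳 (n + 1) M where
  X | 0 => X | k + 1 => r.X k
  K | 0 => M | k + 1 => r.K k
  g | 0 => eqToHom r.start ≫ g | k + 1 => r.g k
  f | 0 => f | k + 1 => r.f k
  mem
    | 0, _ => hX
    | k + 1, hk => r.mem k (by omega)
  conflation
    | 0, _ => by
      obtain ⟨X', K', g', f', mem, confl, start, finish⟩ := r
      subst start
      simpa using h
    | k + 1, hk => r.conflation k (by omega)
  start := rfl
  finish := r.finish

lemma ExtVanish.nonempty_resolution (proj : HasEnoughProjectives C) (inj : HasEnoughInjectives C)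
    {n : ℕ} {M : C} (h : ExtVanish n M) : Nonempty (Resolution (projectives C) n M) := by
  induction n generalizing M with
  | zero => exact ⟨.ofMem (extVanish_zero_iff.1 h)⟩
  | succ n ih =>
    obtain ⟨K, P, g, f, hgf, hP⟩ := proj M
    obtain ⟨r⟩ := ih (hgf.extVanish_left inj hP h)
    exact ⟨.cons g f hgf hP r⟩

lemma extVanish_of_pd_le {n : ℕ} {M : C} (h : pd M ≤ n) : ExtVanish n M := by
  -- A strict bound by n + 1 extracts an actual resolution from the infimum.
  have h' : pd M < ((n + 1 : ℕ) : ℕ∞) := lt_of_le_of_lt h (by exact_mod_cast n.lt_succ_self)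
  unfold pd resDim at h'
  simp only [iInf_lt_iff] at h'
  obtain ⟨m, ⟨r⟩, hm⟩ := h'
  have hm' : m < n + 1 := by exact_mod_cast hm
  exact r.extVanish.mono (by omega)

lemma pd_le_iff (proj : HasEnoughProjectives C) (inj : HasEnoughInjectives C) {n : ℕ} {M : C} :
    pd M ≤ n ↔ ExtVanish n M :=
  ⟨extVanish_of_pd_le, fun h => iInf₂_le n (h.nonempty_resolution proj inj)⟩

lemma pd_le_of_iso (proj : HasEnoughProjectives C) (inj : HasEnoughInjectives C) {M M' : C}
    (e : M ≅ M') : pd M' ≤ pd M := by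
  generalize hn : pd M = n
  induction n with
  | top => exact le_top
  | coe n => exact (pd_le_iff proj inj).2 ((extVanish_of_pd_le hn.le).of_iso e)

lemma pd_eq_zero_of_projectives {P : C} (hP : projectives C P) : pd P = 0 :=
  le_antisymm (iInf₂_le 0 ⟨.ofMem hP⟩) zero_le

lemma pd_le_gl (M : C) : pd M ≤ gl C :=
  le_iSup₂_of_le (f := fun (M : C) (_ : (⊤ : ObjectProperty C) M) => resDim (projectives C) M)
    M trivial le_rfl

/-- A conflation is a right exact sequence. -/
lemma IsConflation.isRightExactSeq (h : IsConflation x y) : IsRightExactSeq x y :=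
  ⟨a, 𝟙 a, x, h, isDeflation_of_isIso _, fun _ _ => inferInstance, (Category.id_comp x).symm⟩

/-- A conflation is a left exact sequence. -/
lemma IsConflation.isLeftExactSeq (h : IsConflation x y) : IsLeftExactSeq x y :=
  ⟨c, y, 𝟙 c, h, isInflation_of_isIso _, fun _ _ => inferInstance, (Category.comp_id y).symm⟩

end Basic

/-! ### Exact functors and projective dimension -/

section Functors

variable {C : Type u₁} [Category.{v₁} C] [Preadditive C] [HasZeroObject C] [HasBinaryBiproducts C]
  [Extriangulated.{w₁} C]
  {D : Type u₂} [Category.{v₂} D] [Preadditive D] [HasZeroObject D] [HasBinaryBiproducts D]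
  [Extriangulated.{w₂} D]

lemma IsExact.map_isConflation {F : C ⥤ D} (hF : IsExact F) {a b c : C} {x : a ⟶ b} {y : b ⟶ c}
    (h : IsConflation x y) : IsConflation (F.map x) (F.map y) := by
  obtain ⟨T⟩ := hF.exact
  obtain ⟨δ, hδ⟩ := h
  exact ⟨T.η c a δ, T.realize x y δ hδ⟩

/-- A left adjoint of an exact functor preserves projectives. -/
lemma projectives_of_adjunction {F : C ⥤ D} {G : D ⥤ C} (adj : F ⊣ G) (hG : IsExact G) {P : C}
    (hP : projectives C P) : projectives D (F.obj P) := by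
  intro a b c x y h f
  obtain ⟨g, hg⟩ := hP _ _ (hG.map_isConflation h) (adj.homEquiv _ _ f)
  refine ⟨(adj.homEquiv _ _).symm g, ?_⟩
  rw [← adj.homEquiv_naturality_right_symm, hg, Equiv.symm_apply_apply]

/-- An exact functor raises vanishing degrees at most by a common bound on the images of
projectives. -/
lemma IsExact.extVanish_map {F : C ⥤ D} (hF : IsExact F) (projC : HasEnoughProjectives C)
    (injC : HasEnoughInjectives C) {s : ℕ}
    (hs : ∀ P : C, projectives C P → ExtVanish s (F.obj P)) {n : ℕ} {M : C}
    (h : ExtVanish n M) : ExtVanish (n + s) (F.obj M) := by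
  induction n generalizing M with
  | zero => exact (hs M (extVanish_zero_iff.1 h)).mono (by omega)
  | succ n ih =>
    obtain ⟨K, P, g, f, hgf, hP⟩ := projC M
    rw [Nat.add_right_comm]
    exact (hF.map_isConflation hgf).extVanish_right (ih (hgf.extVanish_left injC hP h))
      ((hs P hP).mono (by omega))

lemma IsExact.pd_map_le {F : C ⥤ D} (hF : IsExact F) (projC : HasEnoughProjectives C)
    (injC : HasEnoughInjectives C) (projD : HasEnoughProjectives D)
    (injD : HasEnoughInjectives D) (M : C) :
    pd (F.obj M) ≤ gl C + ⨆ (P : C) (_ : projectives C P), pd (F.obj P) := by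
  generalize hs : (⨆ (P : C) (_ : projectives C P), pd (F.obj P)) = s
  generalize hn : gl C = n
  induction s with
  | top => simp
  | coe s =>
    induction n with
    | top => simp
    | coe n =>
      have h₁ : ExtVanish n M := extVanish_of_pd_le (hn ▸ pd_le_gl M)
      have h₂ : ∀ P : C, projectives C P → ExtVanish s (F.obj P) := fun P hP =>
        extVanish_of_pd_le
          (hs ▸ le_iSup₂ (f := fun (P : C) (_ : projectives C P) => pd (F.obj P)) P hP)
      exact_mod_cast (pd_le_iff projD injD).2 (hF.extVanish_map projC injC h₂ h₁)

end Functors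

/-! ### Recollements -/

namespace Recollement

variable {A : Type u₁} [Category.{v₁} A] [Preadditive A] [HasZeroObject A] [HasBinaryBiproducts A]
  [Extriangulated.{w₁} A]
  {B : Type u₂} [Category.{v₂} B] [Preadditive B] [HasZeroObject B] [HasBinaryBiproducts B]
  [Extriangulated.{w₂} B]
  {C : Type u₃} [Category.{v₃} C] [Preadditive C] [HasZeroObject C] [HasBinaryBiproducts C]
  [Extriangulated.{w₃} C] (R : Recollement A B C)

lemma isIso_unit_app_j (Y : C) : IsIso (R.adjShriekPull_j.unit.app Y) := by
  have := R.jShriek_full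
  have := R.jShriek_faithful
  infer_instance

lemma isIso_counit_app_j (Y : C) : IsIso (R.adjPullPush_j.counit.app Y) := by
  have := R.jPush_full
  have := R.jPush_faithful
  infer_instance

/-- The image under `j_!` of a conflation `K ⟶ P ⟶ Y` decomposes into two conflations, where the
failure of exactness comes from `A`. -/
lemma exists_conflations_jShriek (wicC : WIC C) {K P Y : C} {g : K ⟶ P} {f : P ⟶ Y}
    (h : IsConflation g f) :
    ∃ (N L : B) (u : N ⟶ R.jShriek.obj K) (t : R.jShriek.obj K ⟶ L) (l : L ⟶ R.jShriek.obj P),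
      R.iPush.essImage N ∧ IsConflation u t ∧ IsConflation l (R.jShriek.map f) := by
  obtain ⟨L, t, l, hl, ⟨N, u, hut⟩, ht, htl⟩ :=
    R.jShriek_rightExact.rightExact g f h.isRightExactSeq
  -- It remains to show `j^* N = 0`. Since `j^* j_! g` is isomorphic to `g`, (WIC) makes `j^* t` an
  -- inflation; it is also a deflation and compatible, hence invertible.
  refine ⟨N, L, u, t, l, (R.im_eq_ker N).2 ?_, hut, hl⟩
  have hjut := R.jPull_exact.map_isConflation hut
  have := R.isIso_unit_app_j K
  have := R.isIso_unit_app_j P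
  have hinf : IsInflation (R.jPull.map t ≫ R.jPull.map l) := by
    have hnat : R.jPull.map t ≫ R.jPull.map l =
        inv (R.adjShriekPull_j.unit.app K) ≫ g ≫ R.adjShriekPull_j.unit.app P := by
      rw [IsIso.eq_inv_comp, ← R.jPull.map_comp, ← htl]
      exact (R.adjShriekPull_j.unit.naturality g).symm
    rw [hnat]
    exact (isInflation_of_isIso _).comp (IsInflation.comp ⟨_, _, h⟩ (isInflation_of_isIso _))
  have : IsIso (R.jPull.map t) :=
    R.jPull_exact.compatible t ht ((wicC _ _).1 hinf) ⟨_, _, hjut⟩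
  exact hjut.isZero_left

/-- Induction on syzygies of `Y`: passing from `j_! K` to `L` costs no degree, because `N` already
vanishes from degree `m` on, and passing from `L` to `j_! Y` costs one. -/
lemma extVanish_jShriek (wicC : WIC C) (projC : HasEnoughProjectives C)
    (injC : HasEnoughInjectives C) {m : ℕ}
    (hm : ∀ N : B, R.iPush.essImage N → ExtVanish m N) {n : ℕ} {Y : C} (h : ExtVanish n Y) :
    ExtVanish (m + n + 1) (R.jShriek.obj Y) := by
  have hproj : ∀ P : C, projectives C P → ∀ k, ExtVanish k (R.jShriek.obj P) := fun P hP k =>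
    (extVanish_zero_iff.2
      (projectives_of_adjunction R.adjShriekPull_j R.jPull_exact hP)).mono (Nat.zero_le k)
  induction n generalizing Y with
  | zero => exact hproj Y (extVanish_zero_iff.1 h) _
  | succ n ih =>
    obtain ⟨K, P, g, f, hgf, hP⟩ := projC Y
    obtain ⟨N, L, u, t, l, hN, hut, hl⟩ := R.exists_conflations_jShriek wicC hgf
    have hL : ExtVanish (m + n + 1) L :=
      hut.extVanish_right ((hm N hN).mono (by omega)) (ih (hgf.extVanish_left injC hP h))
    exact hl.extVanish_right hL (hproj P hP _)

/-- (R5) splits into two conflations with `j_! j^* X` and objects from A as the known terms; neither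
raises the degree above the bound for `j_!`. -/
lemma extVanish_mid (wicC : WIC C) (projC : HasEnoughProjectives C)
    (injC : HasEnoughInjectives C) {m n : ℕ}
    (hm : ∀ N : B, R.iPush.essImage N → ExtVanish m N) (hn : ∀ Y : C, ExtVanish n Y) (X : B) :
    ExtVanish (m + n + 1) X := by
  obtain ⟨Y, h, K, g₁, g₂, h₁, h₂, -, -⟩ := R.rightSeq X
  have hK : ExtVanish (m + n + 1) K :=
    h₁.extVanish_right ((hm _ (R.iPush.obj_mem_essImage Y)).mono (by omega))
      (R.extVanish_jShriek wicC projC injC hm (hn _))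
  exact h₂.extVanish_mid hK ((hm _ (R.iPush.obj_mem_essImage _)).mono (by omega))

lemma isZero_jPull_iPush (X : A) : IsZero (R.jPull.obj (R.iPush.obj X)) :=
  (R.im_eq_ker _).1 (R.iPush.obj_mem_essImage X)

/-- By the two adjunctions, endomorphisms of `i^! j_* Y` correspond to morphisms out of `j^* i_* i^!
j_* Y`, which is zero. -/
lemma isZero_iShriek_jPush (Y : C) : IsZero (R.iShriek.obj (R.jPush.obj Y)) := by
  rw [IsZero.iff_id_eq_zero]
  apply (R.adjPushShriek_i.homEquiv _ _).symm.injective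
  apply (R.adjPullPush_j.homEquiv _ _).symm.injective
  exact (R.isZero_jPull_iPush _).eq_of_src _ _

lemma isZero_of_essImage_of_isZero_iShriek {N : B} (hN : R.iPush.essImage N)
    (h : IsZero (R.iShriek.obj N)) : IsZero N := by
  obtain ⟨N', ⟨e⟩⟩ := hN
  have he : e.hom = 0 := (R.adjPushShriek_i.homEquiv _ _).injective (h.eq_of_tgt _ _)
  rw [IsZero.iff_id_eq_zero, ← e.inv_hom_id, he, comp_zero]

/-- If `i^!` is exact, then `j_*` preserves deflations. -/
lemma jPush_map_isDeflation (wicC : WIC C) (hi : IsExact R.iShriek) {K M Y : C} {g : K ⟶ M}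
    {f : M ⟶ Y} (h : IsConflation g f) : IsDeflation (R.jPush.map f) := by
  obtain ⟨L, t, l, ht, ⟨N, u, hlu⟩, hl, htl⟩ :=
    R.jPush_leftExact.leftExact g f h.isLeftExactSeq
  have := R.isIso_counit_app_j M
  have := R.isIso_counit_app_j Y
  have hdef : IsDeflation (R.jPull.map t ≫ R.jPull.map l) := by
    have hnat : R.jPull.map t ≫ R.jPull.map l =
        R.adjPullPush_j.counit.app M ≫ f ≫ inv (R.adjPullPush_j.counit.app Y) := by
      rw [← Category.assoc, IsIso.eq_comp_inv, ← R.jPull.map_comp, ← htl]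
      exact R.adjPullPush_j.counit.naturality f
    rw [hnat]
    exact (isDeflation_of_isIso _).comp (IsDeflation.comp ⟨_, _, h⟩ (isDeflation_of_isIso _))
  have hjlu := R.jPull_exact.map_isConflation hlu
  have : IsIso (R.jPull.map l) :=
    R.jPull_exact.compatible l hl ⟨_, _, hjlu⟩ ((wicC _ _).2 hdef)
  have hN : R.iPush.essImage N := (R.im_eq_ker N).2 hjlu.isZero_right
  -- The cone `N` of `l` comes from A, so it suffices that `i^! N = 0`. Exactness of `i^!`, together
  -- with `i^! j_* = 0`, gives this first for `L` and then for `N`.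
  have : IsIso (R.iShriek.map (R.jPush.map g)) :=
    isIso_of_isZero (R.isZero_iShriek_jPush K) (R.isZero_iShriek_jPush M) _
  have hL : IsZero (R.iShriek.obj L) := (hi.map_isConflation ht).isZero_right
  have : IsIso (R.iShriek.map l) := isIso_of_isZero hL (R.isZero_iShriek_jPush Y) _
  have hN0 := R.isZero_of_essImage_of_isZero_iShriek hN (hi.map_isConflation hlu).isZero_right
  have : IsIso l := hlu.isIso_of_isZero hN0
  rw [htl]
  exact IsDeflation.comp ⟨_, _, ht⟩ (isDeflation_of_isIso l)

/-- If `i^!` is exact, then `j^*` preserves projectives. -/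
lemma jPull_projectives (wicC : WIC C) (hi : IsExact R.iShriek) {P : B} (hP : projectives B P) :
    projectives C (R.jPull.obj P) := by
  intro a b c x y h f
  obtain ⟨_, _, h'⟩ := R.jPush_map_isDeflation wicC hi h
  obtain ⟨g, hg⟩ := hP _ _ h' (R.adjPullPush_j.homEquiv _ _ f)
  refine ⟨(R.adjPullPush_j.homEquiv _ _).symm g, ?_⟩
  rw [← R.adjPullPush_j.homEquiv_naturality_right_symm, hg, Equiv.symm_apply_apply]

lemma gl_le_resDimClass_add (wicC : WIC C) (projB : HasEnoughProjectives B)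
    (projC : HasEnoughProjectives C) (injB : HasEnoughInjectives B)
    (injC : HasEnoughInjectives C) :
    gl B ≤ resDimClass (projectives B) R.iPush.essImage + gl C + 1 := by
  generalize hm : resDimClass (projectives B) R.iPush.essImage = m
  generalize hn : gl C = n
  induction m with
  | top => simp
  | coe m =>
    induction n with
    | top => simp
    | coe n =>
      refine iSup₂_le fun X _ => ?_
      have h := R.extVanish_mid wicC projC injC (m := m) (n := n)
        (fun N hN => extVanish_of_pd_le (hm ▸ le_iSup₂
          (f := fun (N : B) (_ : R.iPush.essImage N) => resDim (projectives B) N) N hN))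
        (fun Y => extVanish_of_pd_le (hn ▸ pd_le_gl Y)) X
      exact_mod_cast (pd_le_iff projB injB).2 h

end Recollement

end Extri

open Extri
theorem corollary4p5
    {A : Type u₁} [Category.{v₁} A] [Preadditive A] [HasZeroObject A] [HasBinaryBiproducts A]
    [Extriangulated.{w₁} A]
    {B : Type u₂} [Category.{v₂} B] [Preadditive B] [HasZeroObject B] [HasBinaryBiproducts B]
    [Extriangulated.{w₂} B]
    {C : Type u₃} [Category.{v₃} C] [Preadditive C] [HasZeroObject C] [HasBinaryBiproducts C]
    [Extriangulated.{w₃} C]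
    (wicA : WIC A) (wicB : WIC B) (wicC : WIC C)
    (projA : HasEnoughProjectives A) (projB : HasEnoughProjectives B)
    (projC : HasEnoughProjectives C)
    (injA : HasEnoughInjectives A) (injB : HasEnoughInjectives B) (injC : HasEnoughInjectives C)
    (R : Recollement A B C) :
    (gl B ≤ resDimClass (projectives B) R.iPush.essImage + gl C + 1 ∧
      resDimClass (projectives B) R.iPush.essImage ≤
        gl A + (⨆ (P : A) (_ : projectives A P), pd (R.iPush.obj P)) ∧
      gl B ≤ gl A + gl C + (⨆ (P : A) (_ : projectives A P), pd (R.iPush.obj P)) + 1 ∧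
      gl C ≤ gl B + (⨆ (P : B) (_ : projectives B P), pd (R.jPull.obj P))) ∧
    (IsExact R.iShriek →
      gl B ≤ gl A + gl C + 1 ∧ gl C ≤ gl B) := by
  have ha := R.gl_le_resDimClass_add wicC projB projC injB injC
  have hb : resDimClass (projectives B) R.iPush.essImage ≤
      gl A + (⨆ (P : A) (_ : projectives A P), pd (R.iPush.obj P)) := by
    refine iSup₂_le fun N hN => ?_
    obtain ⟨M, ⟨e⟩⟩ := hN
    exact (pd_le_of_iso projB injB e).trans
      (R.iPush_exact.pd_map_le projA injA projB injB M)
  have hc : gl B ≤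
      gl A + gl C + (⨆ (P : A) (_ : projectives A P), pd (R.iPush.obj P)) + 1 := by
    refine ha.trans ?_
    rw [add_right_comm (gl A)]
    gcongr
  have hd : gl C ≤ gl B + (⨆ (P : B) (_ : projectives B P), pd (R.jPull.obj P)) := by
    refine iSup₂_le fun Y _ => ?_
    -- Every `Y` is `j^*` of an object of B, namely `j_! Y`.
    have := R.isIso_unit_app_j Y
    exact (pd_le_of_iso projC injC (asIso (R.adjShriekPull_j.unit.app Y)).symm).trans
      (R.jPull_exact.pd_map_le projB injB projC injC _)
  refine ⟨⟨ha, hb, hc, hd⟩, fun hi => ⟨?_, ?_⟩⟩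
  · have h0 : (⨆ (P : A) (_ : projectives A P), pd (R.iPush.obj P)) = 0 := by
      refine le_antisymm (iSup₂_le fun P hP => ?_) zero_le
      -- `i_*` is left adjoint to the exact functor `i^!`, so it preserves projectives.
      exact (pd_eq_zero_of_projectives
        (projectives_of_adjunction R.adjPushShriek_i hi hP)).le
    simpa [h0] using hc
  · have h0 : (⨆ (P : B) (_ : projectives B P), pd (R.jPull.obj P)) = 0 := by
      refine le_antisymm (iSup₂_le fun P hP => ?_) zero_le
      exact (pd_eq_zero_of_projectives (R.jPull_projectives wicC hi hP)).le
    simpa [h0] using hd
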